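/- Let $p$ be a prime, let $G$ be a profinite group such that the continuous cohomology group $H^2(G,\mathbb{Q}_p/\mathbb{Z}_p)$ vanishes (trivial action, discrete coefficients), and let $\Pi$ be the maximal pro-$p$ quotient of $G$. Let $\Pi_0=\Pi$, let $\Pi_i$ be the closure of $[\Pi,\Pi_{i-1}]$ for $i\ge 1$, and let $X=\Pi^{\mathrm{ab}}=\Pi/\Pi_1$. Then among the quotients $\Pi/N$ of $\Pi$ by closed normal subgroups $N\subseteq \Pi_1$ for which the kernel of $\Pi/N\to X$ is central in $\Pi/N$, there is a largest one, $Q$. It is $Q=\Pi/\Pi_2$, and the kernel $Z=\ker(Q\to X)$ satisfies $$ Z=\Pi_1/\Pi_2\;\cong\; X\wedge_{\mathbb{Z}_p}X , $$ where $X\wedge_{\mathbb{Z}_p}X$ is the completed exterior square of $X$ in the category of abelian pro-$p$ groups, that is, the inverse limit of the exterior squares of the finite quotients $X/U$ over the open subgroups $U$ of $X$. The equality means that $\Pi_1\to Q$ induces an isomorphism of topological groups $\Pi_1/\Pi_2\to Z$. There is an isomorphism of topological groups $X\wedge_{\mathbb{Z}_p}X\to\Pi_1/\Pi_2$ given by the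 commutator pairing: $\bar x\wedge\bar y\mapsto [x,y]\,\Pi_2$ for $x,y\in\Pi$, where $[x,y]=xyx^{-1}y^{-1}$. -/

import Mathlib

open scoped commutatorElement

universe u

/-! ## Maximal pro-`p` quotient -/

/-- The intersection of all open normal subgroups `U` of `G` such that `G ⧸ U` is a `p`-group. -/
def proPKernel (p : ℕ) (G : Type u) [Group G] [TopologicalSpace G] : Subgroup G :=
  ⨅ U : {U : OpenNormalSubgroup G // IsPGroup p (G ⧸ U.toSubgroup)}, U.1.toSubgroup

instance proPKernel_normal (p : ℕ) (G : Type u) [Group G] [TopologicalSpace G] :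
    (proPKernel p G).Normal :=
  Subgroup.normal_iInf_normal fun U => U.1.isNormal'

/-- The maximal pro-`p` quotient of a profinite group `G`, with the quotient topology. -/
abbrev MaximalProPQuotient (p : ℕ) (G : Type u) [Group G] [TopologicalSpace G] : Type u :=
  G ⧸ proPKernel p G

/-! ## The coefficient module `ℚ_p / ℤ_p` and the second cohomology group -/

/-- The topological group `ℚ_p / ℤ_p` (quotient topology), lifted to an arbitrary universe. -/
abbrev QpModZp (p : ℕ) [Fact p.Prime] : Type u :=
  ULift.{u} (ℚ_[p] ⧸ (PadicInt.subring p).toAddSubgroup)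

/-- The quotient topology on `ℚ_p / ℤ_p` is discrete, since `ℤ_p` is open in `ℚ_p`. -/
theorem qpModZp_discrete (p : ℕ) [Fact p.Prime] : DiscreteTopology (QpModZp.{u} p) := by
  have hopen : IsOpen ((PadicInt.subring p).toAddSubgroup : Set ℚ_[p]) := by
    have : ((PadicInt.subring p).toAddSubgroup : Set ℚ_[p]) = Metric.closedBall 0 1 := by
      ext x
      simp [PadicInt.subring, Subring.toAddSubgroup]
    rw [this]
    exact IsUltrametricDist.isOpen_closedBall _ one_ne_zero
  have : DiscreteTopology (ℚ_[p] ⧸ (PadicInt.subring p).toAddSubgroup) :=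
    QuotientAddGroup.discreteTopology hopen
  exact inferInstance

/-- The continuous cohomology group `H²(G, ℚ_p / ℤ_p)`, for the trivial action of `G` on the
discrete group `ℚ_p / ℤ_p`. -/
noncomputable abbrev H2QpModZp (p : ℕ) [Fact p.Prime] (G : Type u) [Group G] [TopologicalSpace G]
    [IsTopologicalGroup G] : TopModuleCat ℤ :=
  continuousCohomology 2 (TopRep.of (ContRepresentation.trivial ℤ G (QpModZp.{u} p)))

/-! ## The closed lower central series -/

section LowerCentral

variable (P : Type u) [Group P] [TopologicalSpace P] [IsTopologicalGroup P]

/-- The lower central series of a topological group: `P₀ = P`, and `Pᵢ₊₁` is the closure of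
`[P, Pᵢ]`. -/
def closedLCS : ℕ → Subgroup P
  | 0 => ⊤
  | n + 1 => (⁅(⊤ : Subgroup P), closedLCS n⁆).topologicalClosure

instance closedLCS_normal (n : ℕ) : (closedLCS P n).Normal := by
  induction n with
  | zero => exact inferInstanceAs (⊤ : Subgroup P).Normal
  | succ n ih =>
    exact Subgroup.is_normal_topologicalClosure ⁅(⊤ : Subgroup P), closedLCS P n⁆

/-- The topological group `P₁ / P₂`. -/
abbrev LCSGr1 : Type u := closedLCS P 1 ⧸ (closedLCS P 2).subgroupOf (closedLCS P 1)

variable {P} in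
theorem commutator_mem_closedLCS_one (x y : P) : ⁅x, y⁆ ∈ closedLCS P 1 :=
  Subgroup.le_topologicalClosure _
    (Subgroup.commutator_mem_commutator (Subgroup.mem_top x) (Subgroup.mem_top y))

/-! ## The maximal quotient that is a central extension of the abelianization -/

/-- For `N` contained in the kernel of `P → P^ab`, the natural map `P ⧸ N → P^ab`. -/
def quotientToAb (N : Subgroup P) [N.Normal] (hN : N ≤ (commutator P).topologicalClosure) :
    P ⧸ N →* TopologicalAbelianization P :=
  QuotientGroup.map N (commutator P).topologicalClosure (MonoidHom.id P) hN

/-- `N` is a closed normal subgroup of `P` such that `P → P^ab` factors through `P ⧸ N` and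
`P ⧸ N` is a central extension of `P^ab`. -/
def IsCentralExtensionKernel (N : Subgroup P) : Prop :=
  IsClosed (N : Set P) ∧ ∃ (_ : N.Normal) (hN : N ≤ (commutator P).topologicalClosure),
    (quotientToAb P N hN).ker ≤ Subgroup.center (P ⧸ N)

/-- The intersection of all `N` such that `P ⧸ N` is a central extension of `P^ab`. -/
def maxCentralKernel : Subgroup P := sInf {N | IsCentralExtensionKernel P N}

instance maxCentralKernel_normal : (maxCentralKernel P).Normal := by
  rw [maxCentralKernel, sInf_eq_iInf']
  exact Subgroup.normal_iInf_normal fun N => N.2.2.choose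

theorem maxCentralKernel_le : maxCentralKernel P ≤ (commutator P).topologicalClosure := by
  refine sInf_le ⟨Subgroup.isClosed_topologicalClosure _, inferInstance, le_rfl, ?_⟩
  intro z hz
  have : z = 1 := by
    induction z using QuotientGroup.induction_on with
    | H z => exact hz
  rw [this]
  exact one_mem _

/-- The maximal quotient `Q` of `P` that is a central extension of `P^ab`. -/
abbrev MaxCentralQuotient : Type u := P ⧸ maxCentralKernel P

/-- The kernel `Z` of `Q → P^ab`. -/
def maxCentralZ : Subgroup (MaxCentralQuotient P) :=
  (quotientToAb P (maxCentralKernel P) (maxCentralKernel_le P)).ker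

end LowerCentral

/-! ## The completed exterior square -/

section Wedge

variable (M : Type u) [AddCommGroup M] [TopologicalSpace M]

/-- The exterior square of the quotient `M ⧸ U`. If `M ⧸ U` is a finite abelian `p`-group, the
exterior squares over `ℤ` and over `ℤ_p` are the same. -/
def WedgeLevel (U : OpenAddSubgroup M) : Type u := ⋀[ℤ]^2 (M ⧸ U.toAddSubgroup)

noncomputable instance (U : OpenAddSubgroup M) : AddCommGroup (WedgeLevel M U) :=
  inferInstanceAs (AddCommGroup (⋀[ℤ]^2 (M ⧸ U.toAddSubgroup)))

/-- Each exterior square of a (finite) quotient `M ⧸ U` is discrete. -/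
instance (U : OpenAddSubgroup M) : TopologicalSpace (WedgeLevel M U) := ⊥

/-- The natural map from the exterior square of `M ⧸ U` to that of `M ⧸ V`, for `U ≤ V`. -/
noncomputable def wedgeTransition {U V : OpenAddSubgroup M} (h : U ≤ V) :
    WedgeLevel M U →+ WedgeLevel M V :=
  (exteriorPower.map 2 (QuotientAddGroup.map U.toAddSubgroup V.toAddSubgroup
    (AddMonoidHom.id M) h).toIntLinearMap).toAddMonoidHom

/-- The completed exterior square of an abelian pro-`p` group `M`, in the category of abelian
pro-`p` groups: the inverse limit, over the open subgroups `U` of `M`, of the exterior squares of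
the finite `p`-groups `M ⧸ U`, as a topological subgroup of the product of the discrete groups. -/
noncomputable def completedWedge : AddSubgroup (∀ U : OpenAddSubgroup M, WedgeLevel M U) where
  carrier := {f | ∀ (U V : OpenAddSubgroup M) (h : U ≤ V), wedgeTransition M h (f U) = f V}
  zero_mem' := fun U V h => map_zero _
  add_mem' := fun {f g} hf hg U V h => by
    rw [Pi.add_apply, map_add, hf U V h, hg U V h, Pi.add_apply]
  neg_mem' := fun {f} hf U V h => by
    rw [Pi.neg_apply, map_neg, hf U V h, Pi.neg_apply]

/-- The element `x ∧ y` of the completed exterior square. -/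
noncomputable def completedWedge.mk {M : Type u} [AddCommGroup M] [TopologicalSpace M] (x y : M) :
    completedWedge M :=
  ⟨fun U => exteriorPower.ιMulti ℤ 2
      ![(QuotientAddGroup.mk x : M ⧸ U.toAddSubgroup), QuotientAddGroup.mk y], by
    intro U V h
    refine (exteriorPower.map_apply_ιMulti _ _).trans ?_
    congr 1
    ext i
    fin_cases i <;> rfl⟩

end Wedge

section Cohomology

open CategoryTheory Limits

theorem TopModuleCat.subsingleton_of_iso {R : Type*} [Ring R] [TopologicalSpace R]
    {M N : TopModuleCat R} (e : M ≅ N) (h : Subsingleton M) : Subsingleton N :=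
  ⟨fun a b => by
    have key : ∀ c, e.hom.hom (e.inv.hom c) = c := fun c =>
      congrArg (fun f => f.hom c) e.inv_hom_id
    rw [← key a, ← key b, h.elim (e.inv.hom a)]⟩

theorem TopModuleCat.exists_of_subsingleton_homology {R : Type*} [Ring R] [TopologicalSpace R]
    (S : ShortComplex (TopModuleCat R)) (hS : Subsingleton S.homology) (x : S.X₂)
    (hx : S.g.hom x = 0) : ∃ y : S.X₁, S.f.hom y = x := by
  let D : S.LeftHomologyData :=
    ⟨_, _, _, _, _, TopModuleCat.isLimitKer _, by simp, TopModuleCat.isColimitCoker _⟩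
  have hD : Subsingleton D.H := TopModuleCat.subsingleton_of_iso D.homologyIso hS
  have h0 : D.π.hom (⟨x, hx⟩ : S.g.hom.ker) = D.π.hom 0 := hD.elim _ _
  obtain ⟨y, hy⟩ := (Submodule.Quotient.eq _).mp h0
  have h2 := congrArg (fun z => D.i.hom z) hy
  refine ⟨y, ?_⟩
  have h3 : D.i.hom (D.f'.hom y) = S.f.hom y := congrArg (fun f => f.hom y) D.f'_i
  rw [sub_zero] at h2
  exact h3.symm.trans h2

open ContRepresentation TopRep

theorem exists_cochain_of_subsingleton_continuousCohomology_two
    {k : Type*} [Ring k] [TopologicalSpace k]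
    {G : Type u} [Group G] [TopologicalSpace G] [IsTopologicalGroup G]
    {M : Type u} [AddCommGroup M] [Module k M] [TopologicalSpace M] [IsTopologicalAddGroup M]
    [ContinuousSMul k M]
    (h : Subsingleton (continuousCohomology 2 (TopRep.of (ContRepresentation.trivial k G M))))
    (f : C(G × G, M))
    (hf : ∀ x y z, f (y, z) - f (x * y, z) + f (x, y * z) - f (x, y) = 0) :
    ∃ c : C(G, M), ∀ x y, f (x, y) = c x + c y - c (x * y) := by
  let A := TopRep.of (ContRepresentation.trivial k G M)
  let F' : C((G × G) × G, M) :=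
    ⟨fun g => f (g.1.1⁻¹ * g.1.2, g.1.2⁻¹ * g.2), by fun_prop⟩
  let F : C(G, C(G, C(G, M))) := F'.curry.curry
  have hF : F ∈ (resolutionX A 3).ρ.invariants := by
    intro g
    ext x y z
    change f _ = f _
    congr 2 <;> simp [mul_assoc]
  have hdF : (d A 3).hom F = 0 := by
    ext w x y z
    change f _ - (f _ - (f _ - f _)) = 0
    have := hf (w⁻¹ * x) (x⁻¹ * y) (y⁻¹ * z)
    simp only [mul_assoc, mul_inv_cancel_left] at this
    rw [← this]
    abel
  let K := homogeneousCochains A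
  have h' : Subsingleton (K.sc' 1 2 3).homology :=
    TopModuleCat.subsingleton_of_iso
      (ShortComplex.homologyMapIso (K.isoSc' 1 2 3 (by simp) (by simp))) h
  obtain ⟨⟨b, hb⟩, hbF⟩ := TopModuleCat.exists_of_subsingleton_homology (K.sc' 1 2 3) h' ⟨F, hF⟩
    (Subtype.ext ((homogeneousCochains.d_apply A 2 _).trans hdF))
  replace hbF : (d A 2).hom b = F :=
    (homogeneousCochains.d_apply A 1 _).symm.trans (congrArg Subtype.val hbF)
  have hb' (g x y : G) : b (g⁻¹ * x) (g⁻¹ * y) = b x y :=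
    congrArg (fun q : C(G, C(G, M)) => q x y) (hb g)
  have hbF' (x y z : G) : b y z - (b x z - b x y) = f (x⁻¹ * y, y⁻¹ * z) :=
    congrArg (fun q : C(G, C(G, C(G, M))) => q x y z) hbF
  refine ⟨b 1, fun x y => ?_⟩
  have h1 := hbF' 1 x (x * y)
  have h2 := hb' x x (x * y)
  simp only [inv_mul_cancel, inv_mul_cancel_left, inv_one, one_mul] at h1 h2
  rw [← h1, h2]
  abel

end Cohomology

section BilinearAlgebra

/-- A map of two variables that is additive in each of them. -/
structure IsBiadditive {A B C : Type*} [Add A] [Add B] [Add C] (f : A → B → C) : Prop where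
  add_left : ∀ x x' y, f (x + x') y = f x y + f x' y
  add_right : ∀ x y y', f x (y + y') = f x y + f x y'

/-- The homomorphism of homomorphisms attached to a biadditive map. -/
def IsBiadditive.toHom {A B C : Type*} [AddGroup A] [AddGroup B] [AddCommGroup C] {f : A → B → C}
    (hf : IsBiadditive f) : A →+ B →+ C :=
  AddMonoidHom.mk' (fun x => AddMonoidHom.mk' (f x) (hf.add_right x)) fun x x' => by
    ext y
    exact hf.add_left x x' y

theorem IsBiadditive.swap_eq_neg {A C : Type*} [AddGroup A] [AddCommGroup C] {f : A → A → C}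
    (hf : IsBiadditive f) (halt : ∀ x, f x x = 0) (x y : A) : f y x = -f x y := by
  have h := halt (x + y)
  rw [hf.add_left, hf.add_right, hf.add_right, halt, halt, zero_add, add_zero] at h
  exact eq_neg_of_add_eq_zero_right h

theorem exists_projections_of_finite (A : Type*) [AddCommGroup A] [Finite A] :
    ∃ (n : ℕ) (P : Fin n → A →+ A) (g : Fin n → A),
      (∀ x, ∑ i, P i x = x) ∧ ∀ i x, ∃ a : ℤ, P i x = a • g i := by
  classical
  obtain ⟨ι, _, m, -, ⟨e⟩⟩ := AddCommGroup.equiv_directSum_zmod_of_finite' A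
  let s := (Fintype.equivFin ι).symm
  let q (i : ι) : ZMod (m i) →+ A :=
    e.symm.toAddMonoidHom.comp (DirectSum.of (fun i => ZMod (m i)) i)
  refine ⟨Fintype.card ι, fun i => (q (s i)).comp
    ((DirectSum.component ℤ ι (fun i => ZMod (m i)) (s i)).toAddMonoidHom.comp e.toAddMonoidHom),
    fun i => q (s i) 1, fun x => ?_, fun i x => ?_⟩
  · rw [s.sum_comp fun i => ((q i).comp
      ((DirectSum.component ℤ ι (fun i => ZMod (m i)) i).toAddMonoidHom.comp
        e.toAddMonoidHom)) x]
    apply e.injective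
    rw [map_sum]
    simp only [q, AddMonoidHom.comp_apply, AddEquiv.coe_toAddMonoidHom, AddEquiv.apply_symm_apply]
    exact DirectSum.sum_univ_of (e x)
  · obtain ⟨a, ha⟩ := ZMod.intCast_surjective (e x (s i))
    refine ⟨a, ?_⟩
    rw [← map_zsmul, zsmul_one, ha]
    rfl

/-- Over a finite abelian group, every alternating biadditive map is the antisymmetrization of a
biadditive map. -/
theorem IsBiadditive.exists_sub_swap_eq {A C : Type*} [AddCommGroup A] [Finite A] [AddCommGroup C]
    {b : A → A → C} (hb : IsBiadditive b) (halt : ∀ x, b x x = 0) :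
    ∃ f : A → A → C, IsBiadditive f ∧ ∀ x y, f x y - f y x = b x y := by
  classical
  obtain ⟨n, P, g, hP, hg⟩ := exists_projections_of_finite A
  have hdiag (i : Fin n) (x y : A) : b (P i x) (P i y) = 0 := by
    obtain ⟨k, hk⟩ := hg i x
    obtain ⟨l, hl⟩ := hg i y
    have : hb.toHom (P i x) (P i y) = 0 := by
      rw [hk, hl]
      simp only [map_zsmul, AddMonoidHom.smul_apply]
      rw [show hb.toHom (g i) (g i) = 0 from halt _]
      simp
    exact this
  have hsum (x y : A) : b x y = ∑ i, ∑ j, b (P i x) (P j y) := by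
    have : hb.toHom (∑ i, P i x) (∑ j, P j y) = ∑ i, ∑ j, hb.toHom (P i x) (P j y) := by
      simp only [map_sum, AddMonoidHom.finsetSum_apply]
      exact Finset.sum_comm
    rw [hP, hP] at this
    exact this
  refine ⟨fun x y => ∑ i, ∑ j, if j < i then b (P i x) (P j y) else 0, ⟨?_, ?_⟩, ?_⟩
  · intro x x' y
    simp only [← Finset.sum_add_distrib]
    refine Finset.sum_congr rfl fun i _ => Finset.sum_congr rfl fun j _ => ?_
    split_ifs
    · rw [map_add, hb.add_left]
    · simp
  · intro x x' y
    simp only [← Finset.sum_add_distrib]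
    refine Finset.sum_congr rfl fun i _ => Finset.sum_congr rfl fun j _ => ?_
    split_ifs
    · rw [map_add, hb.add_right]
    · simp
  · intro x y
    beta_reduce
    rw [Finset.sum_comm (f := fun i j => if j < i then b (P i y) (P j x) else 0), hsum]
    simp only [← Finset.sum_sub_distrib]
    refine Finset.sum_congr rfl fun i _ => Finset.sum_congr rfl fun j _ => ?_
    rw [hb.swap_eq_neg halt (P i x) (P j y)]
    rcases lt_trichotomy i j with h | rfl | h
    · simp [h, h.not_gt]
    · simp [hdiag]
    · simp [h, h.not_gt]

theorem IsBiadditive.exists_exteriorPower_hom {A C : Type*} [AddCommGroup A] [AddCommGroup C]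
    {b : A → A → C} (hb : IsBiadditive b) (halt : ∀ x, b x x = 0) :
    ∃ φ : ⋀[ℤ]^2 A →+ C, ∀ x y, φ (exteriorPower.ιMulti ℤ 2 ![x, y]) = b x y := by
  let B : A [⋀^Fin 2]→ₗ[ℤ] C :=
    { toFun := fun v => hb.toHom (v 0) (v 1)
      map_update_add' := by
        intro _ v i x y
        fin_cases i <;> simp
      map_update_smul' := by
        intro _ v i c x
        fin_cases i <;> simp [-zsmul_eq_mul]
      map_eq_zero_of_eq' := by
        intro v i j hij hne
        have : v 0 = v 1 := by fin_cases i <;> fin_cases j <;> simp_all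
        rw [this]
        exact halt _ }
  exact ⟨(exteriorPower.alternatingMapLinearEquiv B).toAddMonoidHom, fun x y =>
    exteriorPower.alternatingMapLinearEquiv_apply_ιMulti B _⟩

theorem isBiadditive_exteriorPower_ιMulti (A : Type*) [AddCommGroup A] :
    IsBiadditive fun x y : A => exteriorPower.ιMulti ℤ 2 ![x, y] where
  add_left x x' y := by
    have := (exteriorPower.ιMulti ℤ 2 (M := A)).map_update_add ![0, y] 0 x x'
    have key (u v w : A) : Function.update ![u, v] 0 w = ![w, v] := by
      ext i; fin_cases i <;> rfl
    simpa only [key] using this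
  add_right x y y' := by
    have := (exteriorPower.ιMulti ℤ 2 (M := A)).map_update_add ![x, 0] 1 y y'
    have key (u v w : A) : Function.update ![u, v] 1 w = ![u, w] := by
      ext i; fin_cases i <;> rfl
    simpa only [key] using this

theorem exteriorPower_ιMulti_self {A : Type*} [AddCommGroup A] (x : A) :
    exteriorPower.ιMulti ℤ 2 ![x, x] = 0 :=
  (exteriorPower.ιMulti ℤ 2 (M := A)).map_eq_zero_of_eq ![x, x] (i := 0) (j := 1) rfl (by decide)

theorem closure_range_exteriorPower_ιMulti (A : Type*) [AddCommGroup A] :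
    AddSubgroup.closure {w : ⋀[ℤ]^2 A | ∃ x y, exteriorPower.ιMulti ℤ 2 ![x, y] = w} = ⊤ := by
  rw [← Submodule.span_int_eq_addSubgroupClosure, ← Submodule.top_toAddSubgroup (R := ℤ),
    ← exteriorPower.ιMulti_span]
  congr 2
  ext w
  constructor
  · rintro ⟨x, y, rfl⟩
    exact ⟨_, rfl⟩
  · rintro ⟨v, rfl⟩
    exact ⟨v 0, v 1, congrArg _ (by ext i; fin_cases i <;> rfl)⟩

end BilinearAlgebra

section Characters

variable (p : ℕ) [Fact p.Prime]

noncomputable instance : DivisibleBy (QpModZp.{u} p) ℤ :=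
  Function.Surjective.divisibleBy
    (f := fun x : ℚ_[p] => (ULift.up (QuotientAddGroup.mk x) : QpModZp.{u} p))
    (fun x => by
      obtain ⟨y, hy⟩ := QuotientAddGroup.mk_surjective x.down
      exact ⟨y, congrArg ULift.up hy⟩) fun _ _ => rfl

theorem qpModZp_mk_eq_zero_iff (y : ℚ_[p]) :
    (ULift.up (QuotientAddGroup.mk y) : QpModZp.{u} p) = 0 ↔ ‖y‖ ≤ 1 := by
  rw [← ULift.down_inj]
  exact QuotientAddGroup.eq_zero_iff y

theorem exists_pow_nsmul_qpModZp_eq_zero (x : QpModZp.{u} p) : ∃ n : ℕ, p ^ n • x = 0 := by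
  obtain ⟨x⟩ := x
  obtain ⟨y, rfl⟩ := QuotientAddGroup.mk_surjective x
  obtain ⟨n, hn⟩ := pow_unbounded_of_one_lt ‖y‖ (Nat.one_lt_cast.2 (Fact.out : p.Prime).one_lt)
  refine ⟨n, (qpModZp_mk_eq_zero_iff p (p ^ n • y)).2 ?_⟩
  have hp : (0 : ℝ) < (p : ℝ) ^ n := pow_pos (Nat.cast_pos.2 (Fact.out : p.Prime).pos) n
  rw [nsmul_eq_mul, norm_mul, Nat.cast_pow, norm_pow, Padic.norm_p, inv_pow,
    inv_mul_le_iff₀ hp, mul_one]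
  exact hn.le

theorem exists_hom_qpModZp_ne_zero {B : Type*} [AddCommGroup B] {w : B} (hw : w ≠ 0) {n : ℕ}
    (hn : p ^ n • w = 0) : ∃ χ : B →+ QpModZp.{u} p, χ w ≠ 0 := by
  obtain ⟨k, -, hk⟩ := (Nat.dvd_prime_pow Fact.out).1 (addOrderOf_dvd_of_nsmul_eq_zero hn)
  let z : QpModZp.{u} p := ULift.up (QuotientAddGroup.mk ((p : ℚ_[p]) ^ k)⁻¹)
  have hz : z ≠ 0 := by
    have hk0 : k ≠ 0 := by
      rintro rfl
      exact hw (AddMonoid.addOrderOf_eq_one_iff.1 hk)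
    rw [Ne, qpModZp_mk_eq_zero_iff, norm_inv, norm_pow, Padic.norm_p, inv_pow, inv_inv, not_le]
    exact one_lt_pow₀ (Nat.one_lt_cast.2 (Fact.out : p.Prime).one_lt) hk0
  let f : ZMod (addOrderOf w) →+ B := ZMod.lift _ ⟨zmultiplesHom B w, by simp⟩
  let g : ZMod (addOrderOf w) →+ QpModZp.{u} p := ZMod.lift _ ⟨zmultiplesHom _ z, by
    rw [zmultiplesHom_apply, natCast_zsmul, hk]
    refine (qpModZp_mk_eq_zero_iff p (p ^ k • ((p : ℚ_[p]) ^ k)⁻¹)).2 ?_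
    rw [nsmul_eq_mul, Nat.cast_pow, mul_inv_cancel₀ (pow_ne_zero _ (by
      exact_mod_cast (Fact.out : p.Prime).ne_zero)), norm_one]⟩
  have hf : Function.Injective f := by
    rw [ZMod.lift_injective]
    intro m hm
    rw [ZMod.intCast_zmod_eq_zero_iff_dvd]
    exact addOrderOf_dvd_iff_zsmul_eq_zero.2 hm
  obtain ⟨χ, hχ⟩ := (Module.Baer.of_divisible (QpModZp.{u} p)).extension_property_addMonoidHom f hf g
  refine ⟨χ, ?_⟩
  have := DFunLike.congr_fun hχ ((1 : ℤ) : ZMod _)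
  rw [AddMonoidHom.comp_apply, ZMod.lift_coe, ZMod.lift_coe, zmultiplesHom_apply,
    zmultiplesHom_apply, one_zsmul, one_zsmul] at this
  rwa [this]

end Characters

section CentralQuotient

variable (P : Type u) [Group P] [TopologicalSpace P] [IsTopologicalGroup P]

theorem isClosed_closedLCS_succ (n : ℕ) : IsClosed (closedLCS P (n + 1) : Set P) :=
  Subgroup.isClosed_topologicalClosure _

theorem closedLCS_succ_le (n : ℕ) : closedLCS P (n + 1) ≤ closedLCS P n := by
  have h : ⁅(⊤ : Subgroup P), closedLCS P n⁆ ≤ closedLCS P n := Subgroup.commutator_le_right _ _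
  cases n with
  | zero => exact le_top
  | succ n => exact Subgroup.topologicalClosure_minimal _ h (isClosed_closedLCS_succ P n)

variable {P} in
theorem commutator_mem_closedLCS_succ {n : ℕ} (x : P) {y : P} (hy : y ∈ closedLCS P n) :
    ⁅x, y⁆ ∈ closedLCS P (n + 1) :=
  Subgroup.le_topologicalClosure _ (Subgroup.commutator_mem_commutator (Subgroup.mem_top x) hy)

variable {P} in
theorem commutator_mem_closedLCS_succ' {n : ℕ} {x : P} (hx : x ∈ closedLCS P n) (y : P) :
    ⁅x, y⁆ ∈ closedLCS P (n + 1) := by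
  rw [← commutatorElement_inv]
  exact inv_mem (commutator_mem_closedLCS_succ y hx)

theorem isCentralExtensionKernel_iff (N : Subgroup P) :
    IsCentralExtensionKernel P N ↔ IsClosed (N : Set P) ∧ N.Normal ∧ N ≤ closedLCS P 1 ∧
      closedLCS P 2 ≤ N := by
  refine and_congr_right fun hc => ⟨fun ⟨hn, hN, h⟩ => ⟨hn, hN, ?_⟩, fun ⟨hn, hN, h⟩ => ⟨hn, hN, ?_⟩⟩
  · refine Subgroup.topologicalClosure_minimal _ (Subgroup.commutator_le.2 fun x _ y hy => ?_) hc
    have hy' : (QuotientGroup.mk y : P ⧸ N) ∈ (quotientToAb P N hN).ker :=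
      (QuotientGroup.eq_one_iff y).2 hy
    have := Subgroup.mem_center_iff.1 (h hy') (QuotientGroup.mk x)
    rw [← QuotientGroup.eq_one_iff (N := N)]
    exact commutatorElement_eq_one_iff_mul_comm.2 this
  · intro z hz
    induction z using QuotientGroup.induction_on with
    | H y =>
      have hy : y ∈ closedLCS P 1 := (QuotientGroup.eq_one_iff y).1 hz
      refine Subgroup.mem_center_iff.2 fun x => ?_
      induction x using QuotientGroup.induction_on with
      | H x =>
        exact commutatorElement_eq_one_iff_mul_comm.1
          ((QuotientGroup.eq_one_iff _).2 (h (commutator_mem_closedLCS_succ x hy)))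

theorem isLeast_closedLCS_two :
    IsLeast {N : Subgroup P | IsCentralExtensionKernel P N} (closedLCS P 2) :=
  ⟨(isCentralExtensionKernel_iff P _).2 ⟨isClosed_closedLCS_succ P 1, inferInstance,
    closedLCS_succ_le P 1, le_rfl⟩, fun N hN => ((isCentralExtensionKernel_iff P N).1 hN).2.2.2⟩

theorem maxCentralKernel_eq : maxCentralKernel P = closedLCS P 2 :=
  (isLeast_closedLCS_two P).isGLB.sInf_eq

/-- A continuous bijective homomorphism from a compact group to a Hausdorff group is an isomorphism
of topological groups. -/
@[to_additive /-- A continuous bijective homomorphism from a compact group to a Hausdorff group is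
an isomorphism of topological groups. -/]
noncomputable def continuousMulEquivOfBijective {A B : Type*} [Group A] [Group B]
    [TopologicalSpace A] [TopologicalSpace B] [CompactSpace A] [T2Space B] (f : A →* B)
    (hf : Continuous f) (hb : Function.Bijective f) : A ≃ₜ* B :=
  { MulEquiv.ofBijective f hb with
    continuous_toFun := hf
    continuous_invFun :=
      (Continuous.homeoOfEquivCompactToT2 (f := Equiv.ofBijective f hb) hf).symm.continuous }

theorem exists_LCSGr1_equiv_maxCentralZ [CompactSpace P] :
    ∃ e : LCSGr1 P ≃ₜ* maxCentralZ P, ∀ x : closedLCS P 1,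
      ((e (QuotientGroup.mk x) : maxCentralZ P) : MaxCentralQuotient P) =
        QuotientGroup.mk (x : P) := by
  have hcl : IsClosed (maxCentralKernel P : Set P) := by
    rw [maxCentralKernel_eq]
    exact isClosed_closedLCS_succ P 1
  have : CompactSpace (closedLCS P 1) :=
    isCompact_iff_compactSpace.1 (isClosed_closedLCS_succ P 0).isCompact
  let f : closedLCS P 1 →* maxCentralZ P :=
    ((QuotientGroup.mk' (maxCentralKernel P)).comp (closedLCS P 1).subtype).codRestrict _
      fun x => (QuotientGroup.eq_one_iff (x : P)).2 x.2
  have hf : Continuous f :=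
    Continuous.subtype_mk (QuotientGroup.continuous_mk.comp continuous_subtype_val) _
  have hker (x : closedLCS P 1) : f x = 1 ↔ x ∈ (closedLCS P 2).subgroupOf (closedLCS P 1) := by
    rw [Subgroup.mem_subgroupOf, ← maxCentralKernel_eq, ← QuotientGroup.eq_one_iff (N := maxCentralKernel P),
      Subtype.ext_iff]
    rfl
  let g : LCSGr1 P →* maxCentralZ P := QuotientGroup.lift _ f fun x hx => (hker x).2 hx
  have hg : Function.Bijective g := by
    constructor
    · rw [injective_iff_map_eq_one]
      intro x
      induction x using QuotientGroup.induction_on with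
      | H x => exact fun h => (QuotientGroup.eq_one_iff x).2 ((hker x).1 h)
    · rintro ⟨z, hz⟩
      induction z using QuotientGroup.induction_on with
      | H x => exact ⟨QuotientGroup.mk ⟨x, (QuotientGroup.eq_one_iff x).1 hz⟩, rfl⟩
  exact ⟨continuousMulEquivOfBijective g (hf.quotient_lift _) hg, fun _ => rfl⟩

end CentralQuotient

section CommutatorPairing

variable (P : Type u) [Group P] [TopologicalSpace P] [IsTopologicalGroup P]

/-- `P₁ / P₂` is commutative. -/
abbrev LCSGr1.commGroup : CommGroup (LCSGr1 P) where
  mul_comm a b := by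
    induction a using QuotientGroup.induction_on with
    | H a =>
      induction b using QuotientGroup.induction_on with
      | H b =>
        exact commutatorElement_eq_one_iff_mul_comm.1 ((QuotientGroup.eq_one_iff ⁅a, b⁆).2
          (commutator_mem_closedLCS_succ (a : P) b.2))

attribute [local instance] LCSGr1.commGroup

variable {P}

/-- The class of the commutator of `x` and `y` in `P₁ / P₂`. -/
def commutatorClass (x y : P) : Additive (LCSGr1 P) :=
  Additive.ofMul (QuotientGroup.mk (⟨⁅x, y⁆, commutator_mem_closedLCS_one x y⟩ : closedLCS P 1))

theorem commutatorClass_eq_zero_iff (x y : P) : commutatorClass x y = 0 ↔ ⁅x, y⁆ ∈ closedLCS P 2 :=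
  QuotientGroup.eq_one_iff (⟨⁅x, y⁆, commutator_mem_closedLCS_one x y⟩ : closedLCS P 1)

theorem commutatorClass_mul_left (x x' y : P) :
    commutatorClass (x * x') y = commutatorClass x y + commutatorClass x' y := by
  rw [add_comm, ← zero_add (commutatorClass x' y + _),
    ← (commutatorClass_eq_zero_iff x ⁅x', y⁆).2
      (commutator_mem_closedLCS_succ x (commutator_mem_closedLCS_one x' y))]
  refine congrArg (fun z : closedLCS P 1 => (Additive.ofMul (QuotientGroup.mk z : LCSGr1 P)))
    (Subtype.ext ?_)
  change ⁅x * x', y⁆ = ⁅x, ⁅x', y⁆⁆ * (⁅x', y⁆ * ⁅x, y⁆)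
  simp only [commutatorElement_def]
  group

theorem commutatorClass_swap (x y : P) : commutatorClass y x = -commutatorClass x y :=
  congrArg (fun z : closedLCS P 1 => (Additive.ofMul (QuotientGroup.mk z : LCSGr1 P)))
    (Subtype.ext (commutatorElement_inv x y).symm)

theorem commutatorClass_mul_right (x y y' : P) :
    commutatorClass x (y * y') = commutatorClass x y + commutatorClass x y' := by
  rw [commutatorClass_swap, commutatorClass_mul_left, neg_add, ← commutatorClass_swap,
    ← commutatorClass_swap]

theorem continuous_commutatorClass : Continuous fun q : P × P => commutatorClass q.1 q.2 := by
  refine continuous_ofMul.comp (QuotientGroup.continuous_mk.comp (Continuous.subtype_mk ?_ _))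
  simp only [commutatorElement_def]
  fun_prop

variable (P) in
/-- The commutator pairing on `P^ab` with values in `P₁ / P₂`. -/
theorem exists_commutatorPairing :
    ∃ b : Additive (TopologicalAbelianization P) → Additive (TopologicalAbelianization P) →
        Additive (LCSGr1 P),
      IsBiadditive b ∧ (∀ s, b s s = 0) ∧
        ∀ x y : P, b (Additive.ofMul (QuotientGroup.mk x)) (Additive.ofMul (QuotientGroup.mk y)) =
          commutatorClass x y := by
  have hleft (x x' y : P) (h : (QuotientGroup.mk x : TopologicalAbelianization P) =
      QuotientGroup.mk x') : commutatorClass x y = commutatorClass x' y := by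
    obtain ⟨z, hz, rfl⟩ : ∃ z ∈ closedLCS P 1, x' = x * z :=
      ⟨x⁻¹ * x', QuotientGroup.eq.1 h, by group⟩
    rw [commutatorClass_mul_left, (commutatorClass_eq_zero_iff z y).2
      (commutator_mem_closedLCS_succ' hz y), add_zero]
  have hright (x y y' : P) (h : (QuotientGroup.mk y : TopologicalAbelianization P) =
      QuotientGroup.mk y') : commutatorClass x y = commutatorClass x y' := by
    rw [commutatorClass_swap, hleft y y' x h, ← commutatorClass_swap]
  let b : TopologicalAbelianization P → TopologicalAbelianization P → Additive (LCSGr1 P) :=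
    fun s t => commutatorClass s.out t.out
  have hb (x y : P) : b (QuotientGroup.mk x) (QuotientGroup.mk y) = commutatorClass x y :=
    (hleft _ x _ (Quotient.out_eq _)).trans (hright _ _ _ (Quotient.out_eq _))
  refine ⟨fun s t => b s.toMul t.toMul, ⟨fun s s' t => ?_, fun s t t' => ?_⟩, fun s => ?_, hb⟩
  · obtain ⟨x, hx⟩ := QuotientGroup.mk_surjective s.toMul
    obtain ⟨x', hx'⟩ := QuotientGroup.mk_surjective s'.toMul
    obtain ⟨y, hy⟩ := QuotientGroup.mk_surjective t.toMul
    rw [toMul_add, ← hx, ← hx', ← hy, ← QuotientGroup.mk_mul, hb, hb, hb, commutatorClass_mul_left]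
  · obtain ⟨x, hx⟩ := QuotientGroup.mk_surjective s.toMul
    obtain ⟨y, hy⟩ := QuotientGroup.mk_surjective t.toMul
    obtain ⟨y', hy'⟩ := QuotientGroup.mk_surjective t'.toMul
    rw [toMul_add, ← hx, ← hy, ← hy', ← QuotientGroup.mk_mul, hb, hb, hb, commutatorClass_mul_right]
  · refine (commutatorClass_eq_zero_iff _ _).2 ?_
    rw [commutatorElement_self]
    exact one_mem _

/-- A closed subgroup of `P₁ / P₂` that contains the classes of all commutators is everything. -/
theorem eq_top_of_commutatorClass_mem (D : AddSubgroup (Additive (LCSGr1 P)))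
    (hD : IsClosed (D : Set (Additive (LCSGr1 P)))) (h : ∀ x y : P, commutatorClass x y ∈ D) :
    D = ⊤ := by
  let E : Subgroup P := ((AddSubgroup.toSubgroup' D).comap (QuotientGroup.mk' _)).map
    (closedLCS P 1).subtype
  have hE : IsClosed (E : Set P) :=
    (isClosed_closedLCS_succ P 0).isClosedEmbedding_subtypeVal.isClosedMap _
      (hD.preimage (continuous_ofMul.comp QuotientGroup.continuous_mk))
  have hle : closedLCS P 1 ≤ E :=
    Subgroup.topologicalClosure_minimal _
      (Subgroup.commutator_le.2 fun x _ y _ =>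
        ⟨⟨⁅x, y⁆, commutator_mem_closedLCS_one x y⟩, h x y, rfl⟩) hE
  refine (AddSubgroup.eq_top_iff' D).2 fun l => ?_
  obtain ⟨x, hx⟩ := QuotientGroup.mk_surjective l.toMul
  obtain ⟨y, hy, hyx⟩ := hle x.2
  obtain rfl : y = x := Subtype.ext hyx
  have : Additive.ofMul (QuotientGroup.mk y : LCSGr1 P) ∈ D := hy
  rwa [hx] at this

end CommutatorPairing

section CompletedWedge

variable (M : Type u) [AddCommGroup M] [TopologicalSpace M]

instance (U : OpenAddSubgroup M) : DiscreteTopology (WedgeLevel M U) := ⟨rfl⟩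

/-- The element `x ∧ y` of the exterior square of `M ⧸ U`. -/
noncomputable def WedgeLevel.mk {M : Type u} [AddCommGroup M] [TopologicalSpace M]
    (U : OpenAddSubgroup M) (x y : M) : WedgeLevel M U :=
  exteriorPower.ιMulti ℤ 2 ![(QuotientAddGroup.mk x : M ⧸ U.toAddSubgroup), QuotientAddGroup.mk y]

theorem closure_range_wedgeLevel_mk (U : OpenAddSubgroup M) :
    AddSubgroup.closure {w | ∃ x y, WedgeLevel.mk U x y = w} = ⊤ := by
  refine Eq.trans (congrArg _ ?_) (closure_range_exteriorPower_ιMulti (M ⧸ U.toAddSubgroup))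
  ext w
  constructor
  · rintro ⟨x, y, rfl⟩
    exact ⟨_, _, rfl⟩
  · rintro ⟨x, y, rfl⟩
    obtain ⟨x, rfl⟩ := QuotientAddGroup.mk_surjective x
    obtain ⟨y, rfl⟩ := QuotientAddGroup.mk_surjective y
    exact ⟨x, y, rfl⟩

theorem isBiadditive_wedgeLevel_mk (U : OpenAddSubgroup M) :
    IsBiadditive (WedgeLevel.mk (M := M) U) where
  add_left x x' y := (isBiadditive_exteriorPower_ιMulti (M ⧸ U.toAddSubgroup)).add_left
    (QuotientAddGroup.mk x) (QuotientAddGroup.mk x') (QuotientAddGroup.mk y)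
  add_right x y y' := (isBiadditive_exteriorPower_ιMulti (M ⧸ U.toAddSubgroup)).add_right
    (QuotientAddGroup.mk x) (QuotientAddGroup.mk y) (QuotientAddGroup.mk y')

/-- If multiplication by `m` kills `M ⧸ U`, then it kills the exterior square. -/
theorem nsmul_wedgeLevel_eq_zero {U : OpenAddSubgroup M} {m : ℕ} (hm : ∀ x : M, m • x ∈ U)
    (w : WedgeLevel M U) : m • w = 0 := by
  have hle : (AddSubgroup.closure {w | ∃ x y, WedgeLevel.mk U x y = w}) ≤
      (nsmulAddMonoidHom m : WedgeLevel M U →+ WedgeLevel M U).ker := by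
    rw [AddSubgroup.closure_le]
    rintro _ ⟨x, y, rfl⟩
    change m • (isBiadditive_wedgeLevel_mk M U).toHom x y = 0
    rw [← AddMonoidHom.nsmul_apply, ← map_nsmul]
    change WedgeLevel.mk U (m • x) y = 0
    rw [WedgeLevel.mk, (QuotientAddGroup.eq_zero_iff (m • x)).2 (hm x)]
    exact (exteriorPower.ιMulti ℤ 2).map_coord_zero 0 rfl
  rw [closure_range_wedgeLevel_mk] at hle
  exact hle (AddSubgroup.mem_top w)

instance [IsTopologicalAddGroup M] [CompactSpace M] (U : OpenAddSubgroup M) :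
    Finite (WedgeLevel M U) := by
  have hfin : Finite (M ⧸ U.toAddSubgroup) :=
    AddSubgroup.quotient_finite_of_isOpen U.toAddSubgroup U.isOpen'
  have : Module.Finite ℤ (WedgeLevel M U) :=
    inferInstanceAs (Module.Finite ℤ (⋀[ℤ]^2 (M ⧸ U.toAddSubgroup)))
  have hm (x : M) : Nat.card (M ⧸ U.toAddSubgroup) • x ∈ U := by
    rw [← OpenAddSubgroup.mem_toAddSubgroup, ← QuotientAddGroup.eq_zero_iff,
      QuotientAddGroup.mk_nsmul]
    exact card_nsmul_eq_zero'
  refine Module.finite_of_fg_torsion _ fun w => ⟨⟨(Nat.card (M ⧸ U.toAddSubgroup) : ℤ), ?_⟩, ?_⟩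
  · exact mem_nonZeroDivisors_of_ne_zero (Nat.cast_ne_zero.2 Nat.card_pos.ne')
  · exact (natCast_zsmul w _).trans (nsmul_wedgeLevel_eq_zero M hm w)

instance [IsTopologicalAddGroup M] [CompactSpace M] : CompactSpace (completedWedge M) := by
  refine isCompact_iff_compactSpace.1 (IsClosed.isCompact ?_)
  have : (completedWedge M : Set (∀ U : OpenAddSubgroup M, WedgeLevel M U)) =
      ⋂ (U) (V) (h : U ≤ V), {f | wedgeTransition M h (f U) = f V} := by
    ext f
    simp only [Set.mem_iInter]
    rfl
  rw [this]
  refine isClosed_iInter fun U => isClosed_iInter fun V => isClosed_iInter fun h =>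
    isClosed_eq ?_ (continuous_apply V)
  exact continuous_of_discreteTopology.comp (continuous_apply U)

variable {M} in
/-- The projection of the completed exterior square to the exterior square of `M ⧸ U`. -/
noncomputable def completedWedge.proj (U : OpenAddSubgroup M) : completedWedge M →+ WedgeLevel M U :=
  (Pi.evalAddMonoidHom _ U).comp (completedWedge M).subtype

variable {M} in
theorem completedWedge.continuous_proj (U : OpenAddSubgroup M) :
    Continuous (completedWedge.proj U) :=
  (continuous_apply U).comp continuous_subtype_val

/-- The pure wedges generate a dense subgroup of the completed exterior square. -/
theorem completedWedge.eq_top_of_mk_mem (D : AddSubgroup (completedWedge M))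
    (hD : IsClosed (D : Set (completedWedge M))) (h : ∀ x y : M, completedWedge.mk x y ∈ D) :
    D = ⊤ := by
  refine (AddSubgroup.eq_top_iff' D).2 fun w => ?_
  by_contra hw
  obtain ⟨O, hO, hOD⟩ := isOpen_induced_iff.1 hD.isOpen_compl
  have hwO : (w : ∀ U, WedgeLevel M U) ∈ O := by
    have : w ∈ (D : Set (completedWedge M))ᶜ := hw
    rwa [← hOD] at this
  obtain ⟨I, u, hu, hIu⟩ := isOpen_pi_iff.1 hO _ hwO
  have hmap : D.map (completedWedge.proj (I.inf id)) = ⊤ := by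
    rw [eq_top_iff, ← closure_range_wedgeLevel_mk, AddSubgroup.closure_le]
    rintro _ ⟨x, y, rfl⟩
    exact ⟨_, h x y, rfl⟩
  obtain ⟨d, hd, hdw⟩ : completedWedge.proj (I.inf id) w ∈ D.map (completedWedge.proj (I.inf id)) :=
    hmap ▸ AddSubgroup.mem_top _
  have hdO : d ∈ Subtype.val ⁻¹' O := by
    refine hIu fun V hV => ?_
    have hle : I.inf id ≤ V := Finset.inf_le (f := id) hV
    have : d.1 V = w.1 V := by
      rw [← d.2 _ V hle, ← w.2 _ V hle]
      exact congrArg _ hdw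
    rw [this]
    exact (hu V hV).2
  rw [hOD] at hdO
  exact hdO hd

end CompletedWedge

section ClosedGraph

/-- Let `a` and `b` be two families in compact Hausdorff abelian groups that generate dense subgroups.
If `(w, 0)` and `(0, l)`, for `w ≠ 0` and `l ≠ 0`, are separated by closed subgroups from the family of
pairs, then there is an isomorphism of topological groups that takes `a` to `b`. -/
theorem exists_continuousAddEquiv_of_pairings {S W L : Type*} [AddCommGroup W] [TopologicalSpace W]
    [IsTopologicalAddGroup W] [CompactSpace W] [T2Space W]
    [AddCommGroup L] [TopologicalSpace L] [IsTopologicalAddGroup L] [CompactSpace L] [T2Space L]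
    (a : S → W) (b : S → L)
    (ha : ∀ D : AddSubgroup W, IsClosed (D : Set W) → (∀ s, a s ∈ D) → D = ⊤)
    (hb : ∀ D : AddSubgroup L, IsClosed (D : Set L) → (∀ s, b s ∈ D) → D = ⊤)
    (hW : ∀ w : W, w ≠ 0 → ∃ D : AddSubgroup (W × L), IsClosed (D : Set (W × L)) ∧
      (∀ s, (a s, b s) ∈ D) ∧ (w, 0) ∉ D)
    (hL : ∀ l : L, l ≠ 0 → ∃ D : AddSubgroup (W × L), IsClosed (D : Set (W × L)) ∧
      (∀ s, (a s, b s) ∈ D) ∧ (0, l) ∉ D) :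
    ∃ φ : W ≃ₜ+ L, ∀ s, φ (a s) = b s := by
  let Γ : AddSubgroup (W × L) :=
    (AddSubgroup.closure (Set.range fun s => (a s, b s))).topologicalClosure
  have hΓ : IsClosed (Γ : Set (W × L)) := AddSubgroup.isClosed_topologicalClosure _
  have hmem (s : S) : (a s, b s) ∈ Γ :=
    AddSubgroup.le_topologicalClosure _ (AddSubgroup.subset_closure ⟨s, rfl⟩)
  have hmin (D : AddSubgroup (W × L)) (hD : IsClosed (D : Set (W × L)))
      (h : ∀ s, (a s, b s) ∈ D) : Γ ≤ D := by
    refine AddSubgroup.topologicalClosure_minimal _ ((AddSubgroup.closure_le _).2 ?_) hD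
    rintro _ ⟨s, rfl⟩
    exact h s
  have : CompactSpace Γ := isCompact_iff_compactSpace.1 hΓ.isCompact
  let f : Γ →+ W := (AddMonoidHom.fst W L).comp Γ.subtype
  let g : Γ →+ L := (AddMonoidHom.snd W L).comp Γ.subtype
  have hf : Continuous f := continuous_fst.comp continuous_subtype_val
  have hg : Continuous g := continuous_snd.comp continuous_subtype_val
  have hfb : Function.Bijective f := by
    refine ⟨(injective_iff_map_eq_zero f).2 ?_, ?_⟩
    · rintro ⟨⟨w, l⟩, hwl⟩ (rfl : w = 0)
      by_contra hne
      obtain ⟨D, hD, hab, hl⟩ := hL l fun h => hne (Subtype.ext (Prod.ext rfl h))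
      exact hl (hmin D hD hab hwl)
    · rw [← AddMonoidHom.range_eq_top]
      exact ha _ (isCompact_range hf).isClosed fun s => ⟨⟨_, hmem s⟩, rfl⟩
  have hgb : Function.Bijective g := by
    refine ⟨(injective_iff_map_eq_zero g).2 ?_, ?_⟩
    · rintro ⟨⟨w, l⟩, hwl⟩ (rfl : l = 0)
      by_contra hne
      obtain ⟨D, hD, hab, hl⟩ := hW w fun h => hne (Subtype.ext (Prod.ext h rfl))
      exact hl (hmin D hD hab hwl)
    · rw [← AddMonoidHom.range_eq_top]
      exact hb _ (isCompact_range hg).isClosed fun s => ⟨⟨_, hmem s⟩, rfl⟩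
  refine ⟨(continuousAddEquivOfBijective f hf hfb).symm.trans
    (continuousAddEquivOfBijective g hg hgb), fun s => ?_⟩
  have h : (continuousAddEquivOfBijective f hf hfb).symm (a s) = ⟨(a s, b s), hmem s⟩ :=
    (continuousAddEquivOfBijective f hf hfb).symm_apply_apply ⟨(a s, b s), hmem s⟩
  exact congrArg (continuousAddEquivOfBijective g hg hgb) h

end ClosedGraph

section Biadditive

variable {A C : Type*} [AddCommGroup A] [AddCommGroup C] {f : A → A → C}

theorem IsBiadditive.zero_left (hf : IsBiadditive f) (y : A) : f 0 y = 0 := by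
  simpa using hf.add_left 0 0 y

theorem IsBiadditive.zero_right (hf : IsBiadditive f) (x : A) : f x 0 = 0 := by
  simpa using hf.add_right x 0 0

theorem IsBiadditive.exists_quotient (hf : IsBiadditive f) (U : AddSubgroup A)
    (hl : ∀ x ∈ U, ∀ y, f x y = 0) (hr : ∀ x ∈ U, ∀ y, f y x = 0) :
    ∃ g : A ⧸ U → A ⧸ U → C, IsBiadditive g ∧
      ∀ x y : A, g (QuotientAddGroup.mk x) (QuotientAddGroup.mk y) = f x y := by
  let g₁ : A ⧸ U →+ A →+ C := QuotientAddGroup.lift U hf.toHom fun x hx => by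
    ext y
    exact hl x hx y
  let g₂ : A ⧸ U →+ A ⧸ U →+ C := QuotientAddGroup.lift U g₁.flip fun x hx => by
    ext y
    exact hr x hx y
  exact ⟨fun s t => g₂ t s, ⟨fun s s' t => map_add (g₂ t) s s', fun s t t' =>
    DFunLike.congr_fun (map_add g₂ t t') s⟩, fun _ _ => rfl⟩

end Biadditive

section Inflation

variable (p : ℕ) [Fact p.Prime] {G : Type u} [Group G] [TopologicalSpace G]

omit [Fact p.Prime] in
theorem mem_proPKernel_iff {x : G} : x ∈ proPKernel p G ↔
    ∀ U : OpenNormalSubgroup G, IsPGroup p (G ⧸ U.toSubgroup) → x ∈ U.toSubgroup := by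
  simp [proPKernel, Subgroup.mem_iInf]

omit [Fact p.Prime] in
theorem exists_pow_mem_of_proPKernel_le [IsTopologicalGroup G] [CompactSpace G] {H : Subgroup G}
    (hH : IsOpen (H : Set G)) (hle : proPKernel p G ≤ H) (x : G) : ∃ n : ℕ, x ^ p ^ n ∈ H := by
  classical
  let ι := {U : OpenNormalSubgroup G // IsPGroup p (G ⧸ U.toSubgroup)}
  obtain ⟨t, ht⟩ := hH.isClosed_compl.isCompact.elim_finite_subcover
    (fun U : ι => ((U.1.toSubgroup : Set G))ᶜ) (fun U => U.1.toOpenSubgroup.isClosed.isOpen_compl) (by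
      intro y hy
      by_contra h
      simp only [Set.mem_iUnion, Set.mem_compl_iff, not_exists, not_not] at h
      exact hy (hle ((mem_proPKernel_iff p).2 fun U hU => h ⟨U, hU⟩)))
  have hpow (U : ι) : ∃ n : ℕ, x ^ p ^ n ∈ U.1.toSubgroup := by
    obtain ⟨n, hn⟩ := U.2 (QuotientGroup.mk x)
    exact ⟨n, (QuotientGroup.eq_one_iff _).1 hn⟩
  choose n hn using hpow
  refine ⟨t.sup n, ?_⟩
  by_contra h
  obtain ⟨U, hU, hx⟩ : ∃ U ∈ t, x ^ p ^ t.sup n ∉ U.1.toSubgroup := by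
    simpa using ht h
  apply hx
  rw [← Nat.add_sub_cancel' (Finset.le_sup (f := n) hU), pow_add, pow_mul]
  exact pow_mem (hn U) _

/-- A cocycle inflated from a bilinear map on an abelian `p`-torsion quotient of `G` is the coboundary
of a cochain on `G` that is inflated from the maximal pro-`p` quotient. -/
theorem exists_cochain_of_bilinear [IsTopologicalGroup G] [CompactSpace G]
    (hH2 : Subsingleton (H2QpModZp p G))
    {A : Type*} [AddCommGroup A] [TopologicalSpace A] [DiscreteTopology A]
    (q : G →* Multiplicative A) (hq : Continuous q) (hqp : ∀ x, ∃ n : ℕ, q x ^ p ^ n = 1)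
    {f : A → A → QpModZp.{u} p} (hf : IsBiadditive f) :
    ∃ c : C(G, QpModZp.{u} p),
      (∀ x y, c (x * y) = c x + c y + f (q x).toAdd (q y).toAdd) ∧
      ∀ x, ∀ k ∈ proPKernel p G, c (x * k) = c x := by
  have := qpModZp_discrete.{u} p
  have hq' : Continuous fun x => (q x).toAdd := continuous_toAdd.comp hq
  let F : C(G × G, QpModZp.{u} p) := ⟨fun g => f (q g.1).toAdd (q g.2).toAdd,
    (continuous_of_discreteTopology (f := fun a : A × A => f a.1 a.2)).comp
      ((hq'.comp continuous_fst).prodMk (hq'.comp continuous_snd))⟩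
  obtain ⟨c', hc'⟩ := exists_cochain_of_subsingleton_continuousCohomology_two hH2 F fun x y z => by
    change f _ _ - f (q (x * y)).toAdd _ + f _ (q (y * z)).toAdd - f _ _ = 0
    rw [map_mul q, map_mul q, toAdd_mul, toAdd_mul, hf.add_left, hf.add_right]
    abel
  let c : C(G, QpModZp.{u} p) := -c'
  have hc (x y : G) : c (x * y) = c x + c y + f (q x).toAdd (q y).toAdd := by
    have : f (q x).toAdd (q y).toAdd = c' x + c' y - c' (x * y) := hc' x y
    rw [this]
    simp only [c, ContinuousMap.neg_apply]
    abel
  have hc_left (h x : G) (hh : q h = 1) : c (h * x) = c h + c x := by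
    rw [hc, hh, toAdd_one, hf.zero_left, add_zero]
  have hc_right (x h : G) (hh : q h = 1) : c (x * h) = c x + c h := by
    rw [hc, hh, toAdd_one, hf.zero_right, add_zero]
  have hc_one : c 1 = 0 := by simpa using hc_left 1 1 (map_one q)
  have hc_pow (h : G) (hh : q h = 1) (n : ℕ) : c (h ^ n) = n • c h := by
    induction n with
    | zero => simpa using hc_one
    | succ n ih => rw [pow_succ, hc_right _ _ hh, ih, succ_nsmul]
  obtain ⟨N, hN'⟩ : ∃ N : OpenNormalSubgroup G, ∀ h, h ∈ N.toSubgroup ↔ q h = 1 ∧ c h = 0 := ⟨{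
      carrier := {h | q h = 1 ∧ c h = 0}
      one_mem' := ⟨map_one q, hc_one⟩
      mul_mem' := fun {a b} ha hb => ⟨by rw [map_mul, ha.1, hb.1, one_mul], by
        rw [hc_left a b ha.1, ha.2, hb.2, add_zero]⟩
      inv_mem' := fun {a} ha => ⟨by rw [map_inv, ha.1, inv_one], by
        have := hc_left a a⁻¹ ha.1
        rw [mul_inv_cancel, hc_one, ha.2, zero_add] at this
        exact this.symm⟩
      isOpen' := ((isOpen_discrete {(1 : Multiplicative A)}).preimage hq).inter
        ((isOpen_discrete {(0 : QpModZp.{u} p)}).preimage c.continuous)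
      isNormal' := ⟨fun h hh x => by
        have hx : q (x * h * x⁻¹) = 1 := by
          rw [map_mul, map_mul, hh.1, mul_one, ← map_mul, mul_inv_cancel, map_one]
        refine ⟨hx, ?_⟩
        have h1 := hc_left (x * h * x⁻¹) x hx
        rw [inv_mul_cancel_right, hc_right x h hh.1, hh.2, add_zero] at h1
        simpa using h1.symm⟩ }, fun _ => Iff.rfl⟩
  have hN : IsPGroup p (G ⧸ N.toSubgroup) := by
    intro x
    induction x using QuotientGroup.induction_on with
    | H x =>
      obtain ⟨n, hn⟩ := hqp x
      rw [← map_pow] at hn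
      obtain ⟨m, hm⟩ := exists_pow_nsmul_qpModZp_eq_zero p (c (x ^ p ^ n))
      refine ⟨n + m, (QuotientGroup.eq_one_iff (x ^ p ^ (n + m))).2 ?_⟩
      rw [pow_add, pow_mul]
      exact (hN' _).2 ⟨by rw [map_pow, hn, one_pow], by rw [hc_pow _ hn, hm]⟩
  refine ⟨c, hc, fun x k hk => ?_⟩
  have hk' := (hN' k).1 ((mem_proPKernel_iff p).1 hk N hN)
  rw [hc_right x k hk'.1, hk'.2, add_zero]

end Inflation

section Transgression

attribute [local instance] LCSGr1.commGroup

variable {P : Type u} [Group P] [TopologicalSpace P] [IsTopologicalGroup P]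

/-- The transgression: a cochain on `P` whose coboundary is inflated from a bilinear map `f` on a
quotient of `P^ab` restricts to a character of `P₁ / P₂`, given on commutators by the
antisymmetrization of `f`. -/
theorem exists_character_of_cochain {C : Type*} [AddCommGroup C] [TopologicalSpace C] [T1Space C]
    (U : AddSubgroup (Additive (TopologicalAbelianization P)))
    {f : (Additive (TopologicalAbelianization P) ⧸ U) →
      (Additive (TopologicalAbelianization P) ⧸ U) → C} (hf : IsBiadditive f)
    (q : P → Additive (TopologicalAbelianization P) ⧸ U)
    (hq : ∀ x, q x = QuotientAddGroup.mk (Additive.ofMul (QuotientGroup.mk x)))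
    (c : C(P, C)) (hc : ∀ x y, c (x * y) = c x + c y + f (q x) (q y)) :
    ∃ χ : Additive (LCSGr1 P) →+ C, Continuous χ ∧
      ∀ x y : P, χ (commutatorClass x y) = f (q x) (q y) - f (q y) (q x) := by
  have hq1 (y : P) (hy : y ∈ closedLCS P 1) : q y = 0 := by
    rw [hq, (QuotientGroup.eq_one_iff (N := (commutator P).topologicalClosure) y).2 hy]
    rfl
  have hc_left (h x : P) (hh : h ∈ closedLCS P 1) : c (h * x) = c h + c x := by
    rw [hc, hq1 h hh, hf.zero_left, add_zero]
  have hc_right (x h : P) (hh : h ∈ closedLCS P 1) : c (x * h) = c x + c h := by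
    rw [hc, hq1 h hh, hf.zero_right, add_zero]
  have hcomm (x y : P) : c ⁅x, y⁆ = f (q x) (q y) - f (q y) (q x) := by
    have h := hc_left ⁅x, y⁆ (y * x) (commutator_mem_closedLCS_one x y)
    rw [show ⁅x, y⁆ * (y * x) = x * y by rw [commutatorElement_def]; group, hc, hc y x] at h
    rw [sub_eq_iff_eq_add'.2 (by rw [← sub_eq_iff_eq_add.2 h]; abel : f (q x) (q y) =
      f (q y) (q x) + c ⁅x, y⁆)]
  let χ₀ : closedLCS P 1 →* Multiplicative C :=
    MonoidHom.mk' (fun x => Multiplicative.ofAdd (c x)) fun x y => hc_left x y x.2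
  have hχ₀ : Continuous χ₀ := continuous_ofAdd.comp (c.continuous.comp continuous_subtype_val)
  have hcl : IsClosed ((χ₀.ker.map (closedLCS P 1).subtype : Subgroup P) : Set P) :=
    (isClosed_closedLCS_succ P 0).isClosedEmbedding_subtypeVal.isClosedMap _
      ((isClosed_singleton (x := (0 : C))).preimage (continuous_toAdd.comp hχ₀))
  have hle : closedLCS P 2 ≤ χ₀.ker.map (closedLCS P 1).subtype := by
    refine Subgroup.topologicalClosure_minimal _ (Subgroup.commutator_le.2 fun x _ y hy => ?_) hcl
    refine ⟨⟨⁅x, y⁆, commutator_mem_closedLCS_one x y⟩, ?_, rfl⟩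
    change c ⁅x, y⁆ = 0
    rw [hcomm, hq1 y hy, hf.zero_left, hf.zero_right, sub_zero]
  let χ₁ : LCSGr1 P →* Multiplicative C := QuotientGroup.lift _ χ₀ fun x hx => by
    obtain ⟨y, hy, hyx⟩ := hle hx
    obtain rfl : y = x := Subtype.ext hyx
    exact hy
  exact ⟨AddMonoidHom.toMultiplicativeRight.symm χ₁, hχ₀.quotient_lift _, hcomm⟩

end Transgression

section Pairing

attribute [local instance] LCSGr1.commGroup

/-- The subgroup of pairs on which a homomorphism from the exterior square of `M ⧸ U` and a
homomorphism from `L` agree. -/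
noncomputable def completedWedge.graph {M : Type u} [AddCommGroup M] [TopologicalSpace M]
    {L C : Type*} [AddCommGroup L] [AddCommGroup C] (U : OpenAddSubgroup M)
    (β : WedgeLevel M U →+ C) (χ : L →+ C) : AddSubgroup (completedWedge M × L) :=
  ((β.comp (completedWedge.proj U)).comp (AddMonoidHom.fst _ _)).eqLocus
    (χ.comp (AddMonoidHom.snd _ _))

theorem completedWedge.isClosed_graph {M : Type u} [AddCommGroup M] [TopologicalSpace M]
    {L C : Type*} [AddCommGroup L] [TopologicalSpace L] [AddCommGroup C] [TopologicalSpace C]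
    [T2Space C] (U : OpenAddSubgroup M) (β : WedgeLevel M U →+ C) {χ : L →+ C}
    (hχ : Continuous χ) :
    IsClosed (completedWedge.graph U β χ : Set (completedWedge M × L)) :=
  isClosed_eq ((continuous_of_discreteTopology (f := β)).comp
    ((completedWedge.continuous_proj U).comp continuous_fst)) (hχ.comp continuous_snd)

variable {P : Type u} [Group P] [TopologicalSpace P] [IsTopologicalGroup P] [CompactSpace P]

/-- Modulo an open subgroup `V` of `P₁ / P₂`, the commutator pairing factors through the exterior
square of a finite quotient of `P^ab`. -/
theorem exists_wedgeLevel_hom (V : AddSubgroup (Additive (LCSGr1 P)))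
    (hV : IsOpen (V : Set (Additive (LCSGr1 P)))) :
    ∃ (U : OpenAddSubgroup (Additive (TopologicalAbelianization P)))
      (θ : WedgeLevel (Additive (TopologicalAbelianization P)) U →+ Additive (LCSGr1 P) ⧸ V),
      ∀ x y : P, θ (WedgeLevel.mk U (Additive.ofMul (QuotientGroup.mk x))
        (Additive.ofMul (QuotientGroup.mk y))) = QuotientAddGroup.mk (commutatorClass x y) := by
  obtain ⟨b, hb, halt, hbP⟩ := exists_commutatorPairing P
  let f : Additive (TopologicalAbelianization P) → Additive (TopologicalAbelianization P) →
    Additive (LCSGr1 P) ⧸ V := fun s t => QuotientAddGroup.mk (b s t)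
  have hf : IsBiadditive f :=
    ⟨fun s s' t => by simp only [f, hb.add_left]; rfl,
      fun s t t' => by simp only [f, hb.add_right]; rfl⟩
  have hfalt (s) : f s s = 0 := by simp only [f, halt]; rfl
  let U₀ : AddSubgroup (Additive (TopologicalAbelianization P)) := hf.toHom.ker
  have hU₀ (s) : s ∈ U₀ ↔ ∀ t, b s t ∈ V := by
    rw [AddMonoidHom.mem_ker, DFunLike.ext_iff]
    exact forall_congr' fun t => QuotientAddGroup.eq_zero_iff _
  have hopen : IsOpen {x : P | ∀ y : P, commutatorClass x y ∈ V} := by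
    have h := isClosedMap_fst_of_compactSpace (X := P) (Y := P) _
      (hV.preimage continuous_commutatorClass).isClosed_compl
    convert h.isOpen_compl using 1
    ext x
    simp
  have hU₀open : IsOpen (U₀ : Set (Additive (TopologicalAbelianization P))) := by
    have : IsOpen {s : TopologicalAbelianization P | Additive.ofMul s ∈ U₀} := by
      rw [← (QuotientGroup.isQuotientMap_mk (N := (commutator P).topologicalClosure)).isOpen_preimage]
      convert hopen using 1
      ext x
      refine (hU₀ _).trans ⟨fun h y => hbP x y ▸ h _, fun h t => ?_⟩
      obtain ⟨y, hy⟩ := QuotientGroup.mk_surjective t.toMul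
      have := h y
      rwa [← hbP, hy] at this
    exact this.preimage continuous_toMul
  let U : OpenAddSubgroup (Additive (TopologicalAbelianization P)) := ⟨U₀, hU₀open⟩
  have hl : ∀ s ∈ U₀, ∀ t, f s t = 0 := fun s hs t => DFunLike.congr_fun hs t
  obtain ⟨g, hg, hgf⟩ := hf.exists_quotient U₀ hl fun s hs t => by
    rw [hf.swap_eq_neg hfalt s t, hl s hs t, neg_zero]
  obtain ⟨θ, hθ⟩ := hg.exists_exteriorPower_hom fun s => by
    obtain ⟨s, rfl⟩ := QuotientAddGroup.mk_surjective s
    rw [hgf, hfalt]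
  refine ⟨U, θ, fun x y => (hθ _ _).trans ((hgf _ _).trans ?_)⟩
  simp only [f, hbP]

/-- If the closed subgroup `P₂` is an intersection of open subgroups and enough characters of
the exterior squares of the finite quotients of `P^ab` come from characters of `P₁ / P₂`, then
the commutator pairing identifies the completed exterior square of `P^ab` with `P₁ / P₂`. -/
theorem exists_completedWedge_equiv {C : Type*} [AddCommGroup C] [TopologicalSpace C] [T2Space C]
    (hsep : ∀ x ∉ closedLCS P 2, ∃ N : Subgroup P, IsOpen (N : Set P) ∧ closedLCS P 2 ≤ N ∧ x ∉ N)
    (hchar : ∀ (U : OpenAddSubgroup (Additive (TopologicalAbelianization P)))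
      (w : WedgeLevel (Additive (TopologicalAbelianization P)) U), w ≠ 0 →
      ∃ (β : WedgeLevel (Additive (TopologicalAbelianization P)) U →+ C)
        (χ : Additive (LCSGr1 P) →+ C), Continuous χ ∧ β w ≠ 0 ∧
        ∀ x y : P, χ (commutatorClass x y) = β (WedgeLevel.mk U
          (Additive.ofMul (QuotientGroup.mk x)) (Additive.ofMul (QuotientGroup.mk y)))) :
    ∃ φ : completedWedge (Additive (TopologicalAbelianization P)) ≃ₜ+ Additive (LCSGr1 P),
      ∀ x y : P, φ (completedWedge.mk (Additive.ofMul (QuotientGroup.mk x))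
        (Additive.ofMul (QuotientGroup.mk y))) = commutatorClass x y := by
  have : CompactSpace (closedLCS P 1) :=
    isCompact_iff_compactSpace.1 (isClosed_closedLCS_succ P 0).isCompact
  have hcl : IsClosed ((closedLCS P 2).subgroupOf (closedLCS P 1) : Set (closedLCS P 1)) :=
    (isClosed_closedLCS_succ P 1).preimage continuous_subtype_val
  have : T2Space (LCSGr1 P) := inferInstance
  have : T2Space (Additive (LCSGr1 P)) := this
  have : CompactSpace (Additive (LCSGr1 P)) := inferInstance
  have : CompactSpace (Additive (TopologicalAbelianization P)) := inferInstance
  have : IsTopologicalAddGroup (completedWedge (Additive (TopologicalAbelianization P))) :=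
    inferInstance
  have : T2Space (completedWedge (Additive (TopologicalAbelianization P))) := inferInstance
  obtain ⟨φ, hφ⟩ := exists_continuousAddEquiv_of_pairings (S := P × P)
    (fun s => completedWedge.mk (Additive.ofMul (QuotientGroup.mk s.1 : TopologicalAbelianization P))
      (Additive.ofMul (QuotientGroup.mk s.2 : TopologicalAbelianization P)))
    (fun s => commutatorClass s.1 s.2)
    (fun D hD h => completedWedge.eq_top_of_mk_mem _ D hD fun s t => by
      obtain ⟨x, hx⟩ := QuotientGroup.mk_surjective s.toMul
      obtain ⟨y, hy⟩ := QuotientGroup.mk_surjective t.toMul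
      have := h (x, y)
      rwa [hx, hy] at this)
    (fun D hD h => eq_top_of_commutatorClass_mem D hD fun x y => h (x, y))
    (fun w hw => by
      obtain ⟨U, hU⟩ : ∃ U, completedWedge.proj U w ≠ 0 := by
        by_contra! h
        exact hw (Subtype.ext (funext h))
      obtain ⟨β, χ, hχ, hβ, hβχ⟩ := hchar U _ hU
      exact ⟨completedWedge.graph U β χ, completedWedge.isClosed_graph U β hχ,
        fun s => (hβχ s.1 s.2).symm, fun h => hβ (Eq.trans h (map_zero χ))⟩)
    (fun l hl => by
      obtain ⟨x, hx⟩ := QuotientGroup.mk_surjective l.toMul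
      obtain rfl : l = Additive.ofMul (QuotientGroup.mk x) := hx.symm
      obtain ⟨N, hN, hle, hxN⟩ := hsep x fun h => hl ((QuotientGroup.eq_one_iff x).2 h)
      let V : AddSubgroup (Additive (LCSGr1 P)) := Subgroup.toAddSubgroup
        ((N.subgroupOf (closedLCS P 1)).map (QuotientGroup.mk' _))
      have hV : IsOpen (V : Set (Additive (LCSGr1 P))) := by
        have : IsOpen ((QuotientGroup.mk : closedLCS P 1 → LCSGr1 P) ''
            (N.subgroupOf (closedLCS P 1) : Set (closedLCS P 1))) :=
          QuotientGroup.isOpenMap_coe _ (hN.preimage continuous_subtype_val)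
        exact this.preimage continuous_toMul
      have hxV : Additive.ofMul (QuotientGroup.mk x : LCSGr1 P) ∉ V := by
        rintro ⟨y, hy, hyx⟩
        have h1 : y⁻¹ * x ∈ (closedLCS P 2).subgroupOf (closedLCS P 1) := QuotientGroup.eq.1 hyx
        have h2 : ((y⁻¹ * x : closedLCS P 1) : P) ∈ N := hle h1
        exact hxN ((Subgroup.mul_mem_cancel_left N (inv_mem (show (y : P) ∈ N from hy))).1 h2)
      obtain ⟨U, θ, hθ⟩ := exists_wedgeLevel_hom V hV
      have : DiscreteTopology (Additive (LCSGr1 P) ⧸ V) := QuotientAddGroup.discreteTopology hV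
      exact ⟨completedWedge.graph U θ (QuotientAddGroup.mk' V),
        completedWedge.isClosed_graph U θ QuotientAddGroup.continuous_mk, fun s => hθ s.1 s.2,
        fun h => hxV ((QuotientAddGroup.eq_zero_iff _).1 (Eq.trans (Eq.symm h) (map_zero θ)))⟩)
  exact ⟨φ, fun x y => hφ (x, y)⟩

end Pairing

section Main

attribute [local instance] LCSGr1.commGroup

theorem exists_isOpen_subgroup_notMem_of_isClosed {G : Type*} [Group G] [TopologicalSpace G]
    [IsTopologicalGroup G] [CompactSpace G] [TotallyDisconnectedSpace G] (K : Subgroup G) [K.Normal]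
    {H : Subgroup (G ⧸ K)} (hH : IsClosed (H : Set (G ⧸ K))) {x : G ⧸ K} (hx : x ∉ H) :
    ∃ N : Subgroup (G ⧸ K), IsOpen (N : Set (G ⧸ K)) ∧ H ≤ N ∧ x ∉ N := by
  obtain ⟨g, rfl⟩ := QuotientGroup.mk_surjective x
  have h := ProfiniteGrp.closedSubgroup_eq_sInf_open
    (⟨H.comap (QuotientGroup.mk' K), hH.preimage QuotientGroup.continuous_mk⟩ : ClosedSubgroup G)
  have hg : g ∉ H.comap (QuotientGroup.mk' K) := hx
  replace h : H.comap (QuotientGroup.mk' K) =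
    sInf {N : Subgroup G | IsOpen (N : Set G) ∧ H.comap (QuotientGroup.mk' K) ≤ N} := h
  rw [h, Subgroup.mem_sInf] at hg
  push Not at hg
  obtain ⟨N, ⟨hN, hle⟩, hgN⟩ := hg
  refine ⟨N.map (QuotientGroup.mk' K), QuotientGroup.isOpenMap_coe _ hN, ?_, ?_⟩
  · rw [← Subgroup.map_comap_eq_self_of_surjective (QuotientGroup.mk'_surjective K) H]
    exact Subgroup.map_mono hle
  · rintro ⟨n, hn, hng⟩
    have hK : n⁻¹ * g ∈ N := hle (by
      have : (QuotientGroup.mk' K) (n⁻¹ * g) = 1 := (QuotientGroup.eq_one_iff _).2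
        (QuotientGroup.eq.1 hng)
      rw [Subgroup.mem_comap, this]
      exact one_mem _)
    exact hgN ((Subgroup.mul_mem_cancel_left N (inv_mem hn)).1 hK)

/-- If `H²(G, ℚ_p / ℤ_p) = 0`, every nonzero element of the exterior square of a finite quotient of
`Π^ab` is detected by a character that comes from a character of `Π₁ / Π₂`. -/
theorem exists_character_wedgeLevel (p : ℕ) [Fact p.Prime] {G : Type u} [Group G]
    [TopologicalSpace G] [IsTopologicalGroup G] [CompactSpace G]
    (hH2 : Subsingleton (H2QpModZp p G))
    (U : OpenAddSubgroup (Additive (TopologicalAbelianization (MaximalProPQuotient p G))))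
    (w : WedgeLevel (Additive (TopologicalAbelianization (MaximalProPQuotient p G))) U)
    (hw : w ≠ 0) :
    ∃ (β : WedgeLevel (Additive (TopologicalAbelianization (MaximalProPQuotient p G))) U →+
        QpModZp.{u} p)
      (χ : Additive (LCSGr1 (MaximalProPQuotient p G)) →+ QpModZp.{u} p), Continuous χ ∧ β w ≠ 0 ∧
      ∀ x y : MaximalProPQuotient p G, χ (commutatorClass x y) = β (WedgeLevel.mk U
        (Additive.ofMul (QuotientGroup.mk x)) (Additive.ofMul (QuotientGroup.mk y))) := by
  let X := Additive (TopologicalAbelianization (MaximalProPQuotient p G))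
  let A := X ⧸ U.toAddSubgroup
  have hA : DiscreteTopology A := QuotientAddGroup.discreteTopology U.isOpen'
  have hAfin : Finite A := AddSubgroup.quotient_finite_of_isOpen U.toAddSubgroup U.isOpen'
  let r : MaximalProPQuotient p G →* Multiplicative A :=
    MonoidHom.mk' (fun x => Multiplicative.ofAdd (QuotientAddGroup.mk
      (Additive.ofMul (QuotientGroup.mk x : TopologicalAbelianization (MaximalProPQuotient p G)))))
      fun _ _ => rfl
  let q : G →* Multiplicative A := r.comp (QuotientGroup.mk' (proPKernel p G))
  have hr : Continuous r := continuous_ofAdd.comp (QuotientAddGroup.continuous_mk.comp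
    (continuous_ofMul.comp QuotientGroup.continuous_mk))
  have hq : Continuous q := hr.comp QuotientGroup.continuous_mk
  have hr_surj : Function.Surjective r := by
    intro a
    obtain ⟨s, hs⟩ := QuotientAddGroup.mk_surjective a.toAdd
    obtain ⟨x, hx⟩ := QuotientGroup.mk_surjective s.toMul
    refine ⟨x, ?_⟩
    change Multiplicative.ofAdd (QuotientAddGroup.mk (Additive.ofMul (QuotientGroup.mk x))) = a
    rw [hx]
    exact hs
  have hq_surj : Function.Surjective q := hr_surj.comp (QuotientGroup.mk_surjective)
  have hqp (x : G) : ∃ n : ℕ, q x ^ p ^ n = 1 := by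
    obtain ⟨n, hn⟩ := exists_pow_mem_of_proPKernel_le p (H := q.ker)
      ((isOpen_discrete {(1 : Multiplicative A)}).preimage hq)
      (fun k hk => by
        change r (QuotientGroup.mk k) = 1
        rw [(QuotientGroup.eq_one_iff k).2 hk, map_one]) x
    exact ⟨n, by rw [← map_pow]; exact hn⟩
  have hAp : IsPGroup p (Multiplicative A) := fun a => by
    obtain ⟨x, rfl⟩ := hq_surj a
    exact hqp x
  obtain ⟨m, hm⟩ := IsPGroup.iff_card.1 hAp
  have hmX (s : X) : p ^ m • s ∈ U := by
    rw [← OpenAddSubgroup.mem_toAddSubgroup, ← QuotientAddGroup.eq_zero_iff,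
      QuotientAddGroup.mk_nsmul, ← hm]
    exact card_nsmul_eq_zero' (G := A)
  obtain ⟨β, hβ⟩ := exists_hom_qpModZp_ne_zero.{u} p hw (nsmul_wedgeLevel_eq_zero X hmX w)
  let b : A → A → QpModZp.{u} p := fun s t => β (exteriorPower.ιMulti ℤ 2 ![s, t])
  have hb : IsBiadditive b :=
    ⟨fun s s' t => (congrArg β ((isBiadditive_exteriorPower_ιMulti A).add_left s s' t)).trans
      (map_add β _ _), fun s t t' =>
      (congrArg β ((isBiadditive_exteriorPower_ιMulti A).add_right s t t')).trans (map_add β _ _)⟩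
  obtain ⟨f, hf, hfb⟩ := hb.exists_sub_swap_eq fun s =>
    (congrArg β (exteriorPower_ιMulti_self s)).trans (map_zero β)
  obtain ⟨c, hc, hck⟩ := exists_cochain_of_bilinear p hH2 q hq hqp hf
  let c' : C(MaximalProPQuotient p G, QpModZp.{u} p) :=
    ⟨Quotient.lift c fun x y hxy => by
      have := hck x _ (QuotientGroup.leftRel_apply.1 hxy)
      rwa [mul_inv_cancel_left, eq_comm] at this, c.continuous.quotient_lift _⟩
  have := qpModZp_discrete.{u} p
  obtain ⟨χ, hχ, hχf⟩ := exists_character_of_cochain U.toAddSubgroup hf (fun x => (r x).toAdd)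
    (fun _ => rfl) c' fun x y => by
      obtain ⟨x, rfl⟩ := QuotientGroup.mk_surjective x
      obtain ⟨y, rfl⟩ := QuotientGroup.mk_surjective y
      exact hc x y
  exact ⟨β, χ, hχ, hβ, fun x y => (hχf x y).trans (hfb _ _)⟩

end Main

theorem corollary6 (p : ℕ) [Fact p.Prime] (G : Type u) [Group G] [TopologicalSpace G]
    [IsTopologicalGroup G] [CompactSpace G] [T2Space G] [TotallyDisconnectedSpace G]
    (hH2 : Subsingleton (H2QpModZp p G)) :
    IsLeast {N : Subgroup (MaximalProPQuotient p G) |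
        IsCentralExtensionKernel (MaximalProPQuotient p G) N}
      (maxCentralKernel (MaximalProPQuotient p G)) ∧
    maxCentralKernel (MaximalProPQuotient p G) = closedLCS (MaximalProPQuotient p G) 2 ∧
    (∃ e : LCSGr1 (MaximalProPQuotient p G) ≃ₜ* maxCentralZ (MaximalProPQuotient p G),
      ∀ x : closedLCS (MaximalProPQuotient p G) 1,
        ((e (QuotientGroup.mk x) : maxCentralZ (MaximalProPQuotient p G)) :
          MaxCentralQuotient (MaximalProPQuotient p G)) =
            QuotientGroup.mk (x : MaximalProPQuotient p G)) ∧
    (∃ φ : completedWedge (Additive (TopologicalAbelianization (MaximalProPQuotient p G))) ≃ₜ+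
        Additive (LCSGr1 (MaximalProPQuotient p G)),
      ∀ x y : MaximalProPQuotient p G,
        φ (completedWedge.mk
            (Additive.ofMul (QuotientGroup.mk x :
              TopologicalAbelianization (MaximalProPQuotient p G)))
            (Additive.ofMul (QuotientGroup.mk y :
              TopologicalAbelianization (MaximalProPQuotient p G)))) =
          Additive.ofMul (QuotientGroup.mk
            (⟨⁅x, y⁆, commutator_mem_closedLCS_one x y⟩ :
              closedLCS (MaximalProPQuotient p G) 1))) := by
  have hmax := maxCentralKernel_eq (MaximalProPQuotient p G)
  refine ⟨hmax ▸ isLeast_closedLCS_two _, hmax, exists_LCSGr1_equiv_maxCentralZ _, ?_⟩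
  have := qpModZp_discrete.{u} p
  exact exists_completedWedge_equiv
    (fun x hx => exists_isOpen_subgroup_notMem_of_isClosed _ (isClosed_closedLCS_succ _ 1) hx)
    (exists_character_wedgeLevel p hH2)
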